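/- Let $a<0$, $b>0$, $\gamma>0$, $\theta\in\mathbb R$ and $\bar r\neq 0$ be constants. For $t_0\ge 0$ consider, on $[t_0,\infty)$, the scalar adaptive system with open-loop reference model $$\dot x = a x - b\theta x + b u,\qquad u=\hat\theta x+\bar r,\qquad \dot x_m = a x_m + b\bar r,\qquad \dot{\hat\theta} = -\gamma x e,\qquad e = x-x_m,$$ and put $\phi=\hat\theta-\theta$ and $z=[e,\phi]^{\mathsf T}\in\mathbb R^2$, with the Euclidean norm. For all $t_0\ge 0$ and all initial values $x(t_0),x_m(t_0),\hat\theta(t_0)\in\mathbb R$ the system has exactly one solution on $[t_0,\infty)$, and the equilibrium $z=0$ of the error dynamics is uniformly asymptotically stable in the large (UASL). That is: 1. (uniformly stable) for every $\varepsilon>0$ there is $\delta(\varepsilon)>0$ such that $\|z(t_0)\|\le\delta$ implies $\|z(t)\|\le\varepsilon$ for all $t\ge t_0$; 2. (uniformly bounded) for every $\rho>0$ there is $B(\rho)$ such that $\|z(t_0)\|\le\rho$ implies $\|z(t)\|\le B$ for all $t\ge t_0$; 3. (uniformly attracting in the large) for all $\rho>0$ and $\eta>0$ there is $T(\eta,\rho)\ge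 0$ such that $\|z(t_0)\|\le\rho$ implies $\|z(t)\|\le\eta$ for all $t\ge t_0+T$. Here $\delta$, $B$, $T$ may depend on $a,b,\gamma,\theta,\bar r$, but not on the initial time $t_0\ge 0$ nor on the initial values of the solution (in particular not on $x_m(t_0)$). -/

import Mathlib

/-- `[e, φ]ᵀ` as a vector of the Euclidean plane. -/
abbrev Plane : Type := EuclideanSpace ℝ (Fin 2)

/-- The closed-loop scalar adaptive system with open-loop reference model and constant
reference `r`: the functions `x` (plant state), `xm` (reference state) and `θh` (parameter
estimate) solve, on `[t₀, ∞)`,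
`x' = a x - b θ x + b u` with `u = θh x + r`, `xm' = a xm + b r`, `θh' = -γ x e` with `e = x - xm`.
At `t₀` the derivative is the right derivative. -/
structure IsORMSolution (a b θ γ r t₀ : ℝ) (x xm θh : ℝ → ℝ) : Prop where
  plant : ∀ t, t₀ ≤ t →
    HasDerivWithinAt x (a * x t - b * θ * x t + b * (θh t * x t + r)) (Set.Ici t₀) t
  reference : ∀ t, t₀ ≤ t →
    HasDerivWithinAt xm (a * xm t + b * r) (Set.Ici t₀) t
  update : ∀ t, t₀ ≤ t →
    HasDerivWithinAt θh (-γ * x t * (x t - xm t)) (Set.Ici t₀) t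

/-- The error trajectories `z = [e, φ]ᵀ`, `e = x - xm`, `φ = θh - θ`, of the system started at
time `t₀`, over all initial values of `x`, `xm`, `θh`. -/
def ormErrorTrajectories (a b θ γ r t₀ : ℝ) : Set (ℝ → Plane) :=
  {z | ∃ x xm θh : ℝ → ℝ, IsORMSolution a b θ γ r t₀ x xm θh ∧
    ∀ t, t₀ ≤ t → z t = !₂[x t - xm t, θh t - θ]}

section Stability

/-! Stability of the origin for a system given by its trajectories: `S t₀` is the set of
trajectories (on `[t₀, ∞)`) that start at the time `t₀`. -/

variable {E : Type*} [NormedAddCommGroup E]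

/-- Uniform stability of the origin: `δ` depends on `ε` only. -/
def UniformlyStable (S : ℝ → Set (ℝ → E)) : Prop :=
  ∀ ε : ℝ, 0 < ε → ∃ δ : ℝ, 0 < δ ∧ ∀ t₀ : ℝ, 0 ≤ t₀ → ∀ z ∈ S t₀, ‖z t₀‖ ≤ δ → ∀ t ≥ t₀, ‖z t‖ ≤ ε

/-- Uniform boundedness: the bound `B` depends on `ρ` only. -/
def UniformlyBounded (S : ℝ → Set (ℝ → E)) : Prop :=
  ∀ ρ : ℝ, 0 < ρ → ∃ B : ℝ, ∀ t₀ : ℝ, 0 ≤ t₀ → ∀ z ∈ S t₀, ‖z t₀‖ ≤ ρ → ∀ t ≥ t₀, ‖z t‖ ≤ B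

/-- Uniform attraction in the large: the attraction time `T ≥ 0` depends on `ρ` and `η` only. -/
def UniformlyAttractingInTheLarge (S : ℝ → Set (ℝ → E)) : Prop :=
  ∀ ρ : ℝ, 0 < ρ → ∀ η : ℝ, 0 < η → ∃ T : ℝ, 0 ≤ T ∧ ∀ t₀ : ℝ, 0 ≤ t₀ → ∀ z ∈ S t₀,
    ‖z t₀‖ ≤ ρ → ∀ t ≥ t₀ + T, ‖z t‖ ≤ η

/-- Uniform asymptotic stability in the large of the origin. -/
structure IsUASL (S : ℝ → Set (ℝ → E)) : Prop where
  stable : UniformlyStable S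
  bounded : UniformlyBounded S
  attracting : UniformlyAttractingInTheLarge S

end Stability

/-! Put `p = a + b φ`, `s = b r` and `V = γ e² + b φ²`. The closed loop reads `x' = p x + s`, `e' =
a e + b φ x`, `φ' = -γ x e`, so `V' = 2 γ a e² ≤ 0`. This gives stability and boundedness, and
excludes finite escape, but yields no decay in `φ`.

Decay comes from `W = V - l e φ g - k φ² g` with `g = x / (1 + x²)`. The first correction
contributes `-l b q φ²`, `q = x² / (1 + x²)`, which is strict away from `x = 0`. Near `x = 0` the
input `s ≠ 0` drives `x` through zero, so `s g' > 0` (`le_mul_deriv_div_one_add_sq`), and with `k =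
l μ s` the second correction supplies the missing `-φ²`. As `g`, `q` and, for bounded `φ`, also `g'`
are bounded over all `x`, the rate in `W' ≤ -c W` does not involve `xm t₀`
(`exists_lyapunov_coefficients`, `exists_exponential_decay`). -/

open Set Metric Filter Topology

/-! ### Global existence and forward uniqueness for autonomous equations -/

section ODE

variable {E : Type*} [NormedAddCommGroup E] [NormedSpace ℝ E]

/-- A bounded Lipschitz vector field has an integral curve on every bounded interval. -/
theorem exists_hasDerivAt_Ioo_of_lipschitzWith_of_bounded [CompleteSpace E] {v : E → E}
    {K : NNReal} (hv : LipschitzWith K v) {C : ℝ} (hC : ∀ p, ‖v p‖ ≤ C) (t₀ : ℝ) (p : E)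
    {d : ℝ} (hd : 0 ≤ d) :
    ∃ α : ℝ → E, α t₀ = p ∧ ∀ t ∈ Ioo (t₀ - d) (t₀ + d), HasDerivAt α (v (α t)) t := by
  have hC0 : 0 ≤ C := (norm_nonneg _).trans (hC p)
  have hpl : IsPicardLindelof (fun _ => v) (tmin := t₀ - d) (tmax := t₀ + d)
      ⟨t₀, by constructor <;> linarith⟩ p ⟨C * d, mul_nonneg hC0 hd⟩ 0 ⟨C, hC0⟩ K :=
    { lipschitzOnWith := fun _ _ => hv.lipschitzOnWith
      continuousOn := fun _ _ => continuousOn_const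
      norm_le := fun _ _ x _ => hC x
      mul_max_le := by
        simp only [add_sub_cancel_left, sub_sub_cancel, max_self, NNReal.coe_zero, sub_zero]
        exact le_rfl }
  obtain ⟨α, h0, hα⟩ := hpl.exists_eq_forall_mem_Icc_hasDerivWithinAt₀
  exact ⟨α, h0, fun t ht => (hα t (Ioo_subset_Icc_self ht)).hasDerivAt (Icc_mem_nhds ht.1 ht.2)⟩

/-- A bounded Lipschitz vector field has global integral curves. -/
theorem exists_hasDerivAt_of_lipschitzWith_of_bounded [CompleteSpace E] {v : E → E}
    {K : NNReal} (hv : LipschitzWith K v) {C : ℝ} (hC : ∀ p, ‖v p‖ ≤ C) (t₀ : ℝ) (p : E) :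
    ∃ α : ℝ → E, α t₀ = p ∧ ∀ t, HasDerivAt α (v (α t)) t := by
  -- Radius `n + 1` keeps every `t` with `|t - t₀| ≤ n` in the open interval, including `n = 0`.
  have h (n : ℕ) := exists_hasDerivAt_Ioo_of_lipschitzWith_of_bounded hv hC t₀ p
    (d := (n : ℝ) + 1) (by positivity)
  choose α h0 hα using h
  have agree_of_le (m n : ℕ) (hmn : m ≤ n) :
      EqOn (α m) (α n) (Ioo (t₀ - ((m : ℝ) + 1)) (t₀ + ((m : ℝ) + 1))) := by
    have hmn' : (m : ℝ) ≤ n := by exact_mod_cast hmn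
    have hm : (0 : ℝ) ≤ m := m.cast_nonneg
    refine ODE_solution_unique_of_mem_Ioo (v := fun _ => v) (s := fun _ => univ) (t₀ := t₀)
      (fun _ _ => hv.lipschitzOnWith) (by constructor <;> linarith)
      (fun t ht => ⟨hα m t ht, mem_univ _⟩) (fun t ht => ⟨hα n t ?_, mem_univ _⟩)
      ((h0 m).trans (h0 n).symm)
    exact ⟨by linarith [ht.1], by linarith [ht.2]⟩
  have agree (m n : ℕ) (t : ℝ) (hm : |t - t₀| < m + 1) (hn : |t - t₀| < n + 1) :
      α m t = α n t := by
    rw [abs_lt] at hm hn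
    rcases le_total m n with hle | hle
    · exact agree_of_le m n hle ⟨by linarith [hm.1], by linarith [hm.2]⟩
    · exact (agree_of_le n m hle ⟨by linarith [hn.1], by linarith [hn.2]⟩).symm
  have ceil_lt (t : ℝ) : |t - t₀| < (⌈|t - t₀|⌉₊ : ℝ) + 1 :=
    (Nat.le_ceil _).trans_lt (lt_add_one _)
  refine ⟨fun t => α ⌈|t - t₀|⌉₊ t, h0 _, fun t => ?_⟩
  have ht := abs_lt.1 (ceil_lt t)
  refine (hα ⌈|t - t₀|⌉₊ t ⟨by linarith [ht.1], by linarith [ht.2]⟩).congr_of_eventuallyEq ?_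
  have hopen : IsOpen {s : ℝ | |s - t₀| < (⌈|t - t₀|⌉₊ : ℝ) + 1} :=
    isOpen_lt (by fun_prop) continuous_const
  filter_upwards [hopen.mem_nhds (ceil_lt t)] with s hs
  exact agree _ _ s (ceil_lt s) hs

/-- Forward uniqueness of integral curves of a `C¹` vector field. -/
theorem eqOn_Ici_of_hasDerivWithinAt_of_contDiff {v : E → E} (hv : ContDiff ℝ 1 v) {t₀ : ℝ}
    {f g : ℝ → E} (hf : ∀ t, t₀ ≤ t → HasDerivWithinAt f (v (f t)) (Ici t₀) t)
    (hg : ∀ t, t₀ ≤ t → HasDerivWithinAt g (v (g t)) (Ici t₀) t) (h0 : f t₀ = g t₀) :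
    EqOn f g (Ici t₀) := by
  intro T hT
  have hfc : ContinuousOn f (Icc t₀ T) := fun t ht =>
    (hf t ht.1).continuousWithinAt.mono Icc_subset_Ici_self
  have hgc : ContinuousOn g (Icc t₀ T) := fun t ht =>
    (hg t ht.1).continuousWithinAt.mono Icc_subset_Ici_self
  obtain ⟨K, hK⟩ := hv.locallyLipschitz.locallyLipschitzOn.exists_lipschitzOnWith_of_compact
    ((isCompact_Icc.image_of_continuousOn hfc).union (isCompact_Icc.image_of_continuousOn hgc))
  refine ODE_solution_unique_of_mem_Icc_right (v := fun _ => v)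
    (fun _ _ => hK) hfc (fun t ht => (hf t ht.1).mono (Ici_subset_Ici.2 ht.1))
    (fun t ht => Or.inl (mem_image_of_mem _ (Ico_subset_Icc_self ht))) hgc
    (fun t ht => (hg t ht.1).mono (Ici_subset_Ici.2 ht.1))
    (fun t ht => Or.inr (mem_image_of_mem _ (Ico_subset_Icc_self ht))) h0 (right_mem_Icc.2 hT)

end ODE

/-! ### Scalar differential inequalities -/

/-- A function with nonpositive derivative on `[t₀, ∞)` stays below its initial value. -/
theorem le_of_hasDerivWithinAt_Ici_nonpos {f f' : ℝ → ℝ} {t₀ : ℝ}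
    (hf : ∀ t, t₀ ≤ t → HasDerivWithinAt f (f' t) (Ici t₀) t) (hf' : ∀ t, t₀ ≤ t → f' t ≤ 0)
    {t : ℝ} (ht : t₀ ≤ t) : f t ≤ f t₀ := by
  refine antitoneOn_of_hasDerivWithinAt_nonpos (convex_Ici t₀)
    (fun s hs => (hf s hs).continuousWithinAt) (f' := f') (fun s hs => ?_) (fun s hs => ?_)
    self_mem_Ici ht ht
  · exact (hf s (interior_subset hs)).mono interior_subset
  · exact hf' s (interior_subset hs)

/-- Exponential decay from a linear differential inequality on `[t₀, ∞)`. -/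
theorem le_mul_exp_of_hasDerivWithinAt_Ici {f f' : ℝ → ℝ} {t₀ c : ℝ}
    (hf : ∀ t, t₀ ≤ t → HasDerivWithinAt f (f' t) (Ici t₀) t)
    (hf' : ∀ t, t₀ ≤ t → f' t ≤ -c * f t) {t : ℝ} (ht : t₀ ≤ t) :
    f t ≤ f t₀ * Real.exp (-(c * (t - t₀))) := by
  have hexp (s : ℝ) : HasDerivWithinAt (fun s => Real.exp (c * (s - t₀)))
      (Real.exp (c * (s - t₀)) * c) (Ici t₀) s := by
    simpa using ((((hasDerivAt_id s).sub_const t₀).const_mul c).exp).hasDerivWithinAt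
  have key := le_of_hasDerivWithinAt_Ici_nonpos
    (fun s hs => (hf s hs).mul (hexp s)) (fun s hs => ?_) ht
  · simp only [Pi.mul_apply, sub_self, mul_zero, Real.exp_zero, mul_one] at key
    rw [Real.exp_neg, ← div_eq_mul_inv, le_div_iff₀ (Real.exp_pos _)]
    exact key
  · have := mul_le_mul_of_nonneg_right (hf' s hs) (Real.exp_pos (c * (s - t₀))).le
    linarith

/-! ### The bounded multiplier `x / (1 + x²)` -/

/-- The derivative of `x / (1 + x²)`. -/
theorem hasDerivAt_div_one_add_sq (x : ℝ) :
    HasDerivAt (fun x : ℝ => x / (1 + x ^ 2)) ((1 - x ^ 2) / (1 + x ^ 2) ^ 2) x := by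
  have hx : (1 + x ^ 2 : ℝ) ≠ 0 := by positivity
  refine ((hasDerivAt_id x).div ((hasDerivAt_pow 2 x).const_add 1) hx).congr_deriv ?_
  simp only [id]
  field_simp
  ring

theorem abs_div_one_add_sq_le (x : ℝ) : |x / (1 + x ^ 2)| ≤ 1 / 2 := by
  rw [abs_div, abs_of_pos (show (0 : ℝ) < 1 + x ^ 2 by positivity), div_le_iff₀ (by positivity)]
  nlinarith [sq_nonneg (|x| - 1), sq_abs x]

theorem abs_one_sub_sq_div_le (x : ℝ) : |(1 - x ^ 2) / (1 + x ^ 2) ^ 2| ≤ 1 / (1 + x ^ 2) := by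
  have h : (0 : ℝ) < 1 + x ^ 2 := by positivity
  rw [abs_div, abs_of_pos (show (0 : ℝ) < (1 + x ^ 2) ^ 2 by positivity),
    div_le_div_iff₀ (by positivity) h]
  have : |1 - x ^ 2| ≤ 1 + x ^ 2 := by rw [abs_le]; constructor <;> nlinarith [sq_nonneg x]
  nlinarith

/-- Along `x' = p x + s`, the derivative of `x / (1 + x²)` is bounded for all `x`. -/
theorem abs_deriv_div_one_add_sq_le (p s x : ℝ) :
    |(1 - x ^ 2) / (1 + x ^ 2) ^ 2 * (p * x + s)| ≤ |p| + |s| := by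
  have h : (0 : ℝ) < 1 + x ^ 2 := by positivity
  rw [abs_mul]
  have h1 : |p * x + s| ≤ |p| * |x| + |s| := (abs_add_le _ _).trans (by rw [abs_mul])
  have h2 : |p| * |x| + |s| ≤ (|p| + |s|) * (1 + x ^ 2) := by
    have : |x| ≤ 1 + x ^ 2 := by nlinarith [sq_nonneg (|x| - 1), sq_abs x, abs_nonneg x]
    nlinarith [abs_nonneg p, abs_nonneg s, sq_nonneg x,
      mul_le_mul_of_nonneg_left this (abs_nonneg p), mul_nonneg (abs_nonneg s) (sq_nonneg x)]
  calc _ ≤ 1 / (1 + x ^ 2) * ((|p| + |s|) * (1 + x ^ 2)) :=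
        mul_le_mul (abs_one_sub_sq_div_le x) (h1.trans h2) (abs_nonneg _) (by positivity)
    _ = _ := by field_simp

/-- Along `x' = p x + s`, the function `s x / (1 + x²)` increases near `x = 0`. -/
theorem le_mul_deriv_div_one_add_sq (p s x : ℝ) :
    s ^ 2 / 2 - (3 * s ^ 2 + p ^ 2) * (x ^ 2 / (1 + x ^ 2)) ≤
      s * ((1 - x ^ 2) / (1 + x ^ 2) ^ 2 * (p * x + s)) := by
  have h : (0 : ℝ) < 1 + x ^ 2 := by positivity
  have e1 : s * ((1 - x ^ 2) / (1 + x ^ 2) ^ 2 * (p * x + s)) =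
      s * ((1 - x ^ 2) * (p * x + s)) / (1 + x ^ 2) ^ 2 := by ring
  have e2 : s ^ 2 / 2 - (3 * s ^ 2 + p ^ 2) * (x ^ 2 / (1 + x ^ 2)) =
      (s ^ 2 / 2 * (1 + x ^ 2) ^ 2 - (3 * s ^ 2 + p ^ 2) * (x ^ 2 * (1 + x ^ 2))) /
        (1 + x ^ 2) ^ 2 := by field_simp
  rw [e1, e2]
  gcongr
  -- Right minus left is `(s + p x)² / 2 + (s x - p x²)² / 2` plus nonnegative multiples of `s² x²`,
  -- `p² x²`, `s² x⁴`, `p² x⁴`.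
  nlinarith [sq_nonneg (s + p * x), sq_nonneg (s - p * x), sq_nonneg (x * (s + p * x)),
    sq_nonneg (x * (s - p * x)), sq_nonneg (s * x), sq_nonneg (s * x ^ 2),
    sq_nonneg (p * x ^ 2), sq_nonneg (p * x)]

/-! ### The strict Lyapunov function -/

/-- The correction terms of the strict Lyapunov function are dominated by its quadratic part. -/
theorem abs_lyapunov_correction_le {b γ s l μ e φ g : ℝ} (hl : 0 ≤ l) (hμ : 0 ≤ μ)
    (hlγ : l * (1 + 2 * μ * |s|) ≤ γ) (hlb : l * (1 + 2 * μ * |s|) ≤ b) (hg : |g| ≤ 1 / 2) :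
    |l * (e * φ * g) + l * μ * s * (φ ^ 2 * g)| ≤ (γ * e ^ 2 + b * φ ^ 2) / 2 := by
  have hb1 : |e * φ * g| ≤ (e ^ 2 + φ ^ 2) / 2 * (1 / 2) := by
    rw [abs_mul]
    refine mul_le_mul ?_ hg (abs_nonneg _) (by positivity)
    rw [abs_mul]
    linarith [sq_nonneg (|e| - |φ|), sub_sq |e| |φ|, sq_abs e, sq_abs φ]
  have hb2 : |μ * (s * (φ ^ 2 * g))| ≤ μ * (|s| * (φ ^ 2 * (1 / 2))) := by
    rw [abs_mul, abs_mul, abs_mul, abs_of_nonneg hμ, abs_of_nonneg (sq_nonneg φ)]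
    gcongr
  have h1 : |e * φ * g + μ * (s * (φ ^ 2 * g))| ≤ (1 + 2 * μ * |s|) * (e ^ 2 + φ ^ 2) / 2 := by
    refine (abs_add_le _ _).trans ((add_le_add hb1 hb2).trans ?_)
    have : 0 ≤ μ * |s| := by positivity
    linarith [mul_nonneg this (sq_nonneg e), mul_nonneg this (sq_nonneg φ), sq_nonneg e,
      sq_nonneg φ]
  rw [show l * (e * φ * g) + l * μ * s * (φ ^ 2 * g) = l * (e * φ * g + μ * (s * (φ ^ 2 * g)))
    by ring, abs_mul, abs_of_nonneg hl]
  linarith [mul_le_mul_of_nonneg_left h1 hl, mul_le_mul_of_nonneg_right hlγ (sq_nonneg e),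
    mul_le_mul_of_nonneg_right hlb (sq_nonneg φ)]

/-- The derivative of the correction terms is negative definite in `φ`. -/
theorem lyapunov_correction_deriv_le {a b γ s D C μ m N e φ g q d : ℝ} (hγ : 0 ≤ γ)
    (hμ : 0 ≤ μ) (hμC : μ * C ≤ b) (hm : m = μ * s ^ 2 / 2) (hm0 : 0 < m)
    (hN : N = |a| + D + 2 * γ * μ * |s|) (hg : |g| ≤ 1) (hq0 : 0 ≤ q) (hq1 : q ≤ 1)
    (hd : |d| ≤ D) (hsd : s ^ 2 / 2 - C * q ≤ s * d) :
    -(a * e * φ * g) - q * (b * φ ^ 2 - γ * e ^ 2) - e * φ * d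
      + 2 * γ * μ * (s * (q * (e * φ))) - μ * (φ ^ 2 * (s * d)) ≤
      (γ + N ^ 2 / (2 * m)) * e ^ 2 - m / 2 * φ ^ 2 := by
  have t1 : -(a * e * φ * g) ≤ |a| * |e * φ| := by
    refine (neg_le_abs _).trans ?_
    rw [show a * e * φ * g = a * (e * φ) * g by ring, abs_mul, abs_mul a]
    exact mul_le_of_le_one_right (by positivity) hg
  have t2 : -(e * φ * d) ≤ D * |e * φ| := by
    refine (neg_le_abs _).trans ?_
    rw [abs_mul, mul_comm]
    gcongr
  have t3 : s * (q * (e * φ)) ≤ |s| * |e * φ| := by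
    refine (le_abs_self _).trans ?_
    rw [abs_mul, abs_mul, abs_of_nonneg hq0]
    gcongr
    exact mul_le_of_le_one_left (abs_nonneg _) hq1
  -- The loss `μ C q φ²` away from `x = 0` is at most `b q φ²`, which the first correction cancels.
  have t4 : -(μ * (φ ^ 2 * (s * d))) ≤ -(m * φ ^ 2) + b * q * φ ^ 2 := by
    have h1 := mul_le_mul_of_nonneg_left hsd (mul_nonneg hμ (sq_nonneg φ))
    have h2 := mul_le_mul_of_nonneg_right hμC (mul_nonneg hq0 (sq_nonneg φ))
    rw [hm]
    linarith
  have t5 : q * (γ * e ^ 2) ≤ γ * e ^ 2 := mul_le_of_le_one_left (by positivity) hq1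
  -- Young's inequality, spending half of `m φ²` on all the cross terms.
  have t6 : N * |e * φ| ≤ m / 2 * φ ^ 2 + N ^ 2 / (2 * m) * e ^ 2 := by
    have e1 : m / 2 * φ ^ 2 + N ^ 2 / (2 * m) * e ^ 2 - N * |e * φ| =
        (m * |φ| - N * |e|) ^ 2 / (2 * m) := by
      rw [abs_mul, ← sq_abs e, ← sq_abs φ]
      field_simp
      ring
    have : 0 ≤ (m * |φ| - N * |e|) ^ 2 / (2 * m) := by positivity
    linarith
  have t7 : 2 * γ * μ * (s * (q * (e * φ))) ≤ 2 * γ * μ * (|s| * |e * φ|) :=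
    mul_le_mul_of_nonneg_left t3 (by positivity)
  have t8 : N * |e * φ| = |a| * |e * φ| + D * |e * φ| + 2 * γ * μ * (|s| * |e * φ|) := by
    rw [hN]; ring
  linarith

/-- The coefficients of a strict Lyapunov function. The variables `g`, `q`, `d` stand for
`x / (1 + x²)`, `x² / (1 + x²)` and the derivative of the former along the flow, and `s = b r`. -/
theorem exists_lyapunov_coefficients {a b γ s D C : ℝ} (ha : a < 0) (hb : 0 < b) (hγ : 0 < γ)
    (hs : s ≠ 0) (hD : 0 ≤ D) (hC : 0 ≤ C) :
    ∃ l k c : ℝ, 0 < c ∧ ∀ e φ g q d : ℝ, |g| ≤ 1 / 2 → 0 ≤ q → q ≤ 1 → |d| ≤ D →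
      s ^ 2 / 2 - C * q ≤ s * d →
      (γ * e ^ 2 + b * φ ^ 2) / 2 ≤
        γ * e ^ 2 + b * φ ^ 2 - l * (e * φ * g) - k * (φ ^ 2 * g) ∧
      γ * e ^ 2 + b * φ ^ 2 - l * (e * φ * g) - k * (φ ^ 2 * g) ≤
        2 * (γ * e ^ 2 + b * φ ^ 2) ∧
      2 * γ * a * e ^ 2 - l * (a * e * φ * g + q * (b * φ ^ 2 - γ * e ^ 2) + e * φ * d)
          - k * (-(2 * γ * q * e * φ) + φ ^ 2 * d) ≤
        -c * (γ * e ^ 2 + b * φ ^ 2 - l * (e * φ * g) - k * (φ ^ 2 * g)) := by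
  obtain ⟨μ, hμ, hμC⟩ : ∃ μ : ℝ, 0 < μ ∧ μ * C ≤ b :=
    ⟨b / (C + 1), by positivity, by rw [div_mul_eq_mul_div, div_le_iff₀ (by positivity)]; nlinarith⟩
  set m : ℝ := μ * s ^ 2 / 2 with hm
  have hm0 : 0 < m := by positivity
  set N : ℝ := |a| + D + 2 * γ * μ * |s| with hN
  -- `l X = Y` makes `l` small enough twice: the `e²` terms produced by the corrections use at most
  -- half of `2 γ |a| e²`, and the corrections stay below `V / 2`.
  set X : ℝ := 1 + γ + N ^ 2 / (2 * m) + 2 * μ * |s| with hX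
  have hX1 : 0 < X := by positivity
  set Y : ℝ := min (γ * -a) (min γ b) with hY
  have hY0 : 0 < Y := lt_min (mul_pos hγ (by linarith)) (lt_min hγ hb)
  obtain ⟨l, hl, hlX⟩ : ∃ l : ℝ, 0 < l ∧ l * X = Y := ⟨Y / X, by positivity, by field_simp⟩
  have hlm : 0 < l * m := mul_pos hl hm0
  have hY1 : Y ≤ γ * -a := min_le_left _ _
  have hY2 : Y ≤ γ := (min_le_right _ _).trans (min_le_left _ _)
  have hY3 : Y ≤ b := (min_le_right _ _).trans (min_le_right _ _)
  have hl1 : l * (γ + N ^ 2 / (2 * m)) ≤ γ * -a := by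
    refine (mul_le_mul_of_nonneg_left ?_ hl.le).trans (hlX.le.trans hY1)
    have : 0 ≤ 2 * μ * |s| := by positivity
    linarith
  have hl2 : l * (1 + 2 * μ * |s|) ≤ Y := by
    refine (mul_le_mul_of_nonneg_left ?_ hl.le).trans hlX.le
    have : 0 ≤ N ^ 2 / (2 * m) := by positivity
    linarith
  -- What remains is `-γ |a| e² - (l m / 2) φ²`; it must dominate `c W ≤ 2 c V`.
  obtain ⟨c, hc, hca, hcb⟩ : ∃ c : ℝ, 0 < c ∧ 2 * c ≤ -a ∧ 2 * c * b ≤ l * m / 2 := by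
    refine ⟨min (-a / 2) (l * m / (4 * b)), lt_min (by linarith) (by positivity), ?_, ?_⟩
    · linarith [min_le_left (-a / 2) (l * m / (4 * b))]
    · have := mul_le_mul_of_nonneg_right (min_le_right (-a / 2) (l * m / (4 * b))) hb.le
      have e : l * m / (4 * b) * b = l * m / 4 := by field_simp
      linarith
  refine ⟨l, l * μ * s, c, hc, fun e φ g q d hg hq0 hq1 hd hsd => ?_⟩
  have hs12 := abs_le.1 (abs_lyapunov_correction_le (e := e) (φ := φ) hl.le hμ.le
    (hl2.trans hY2) (hl2.trans hY3) hg)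
  have hV : 0 ≤ γ * e ^ 2 + b * φ ^ 2 := by positivity
  have hW : γ * e ^ 2 + b * φ ^ 2 - l * (e * φ * g) - l * μ * s * (φ ^ 2 * g) ≤
      2 * (γ * e ^ 2 + b * φ ^ 2) := by linarith [hs12.1]
  refine ⟨by linarith [hs12.2], hW, ?_⟩
  have inner := lyapunov_correction_deriv_le (a := a) (e := e) (φ := φ) hγ.le hμ.le hμC hm hm0 hN
    (hg.trans (by norm_num)) hq0 hq1 hd hsd
  have h1 := mul_le_mul_of_nonneg_left inner hl.le
  have h2 := mul_le_mul_of_nonneg_right hl1 (sq_nonneg e)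
  have h3 := mul_le_mul_of_nonneg_left hW hc.le
  have h4 := mul_le_mul_of_nonneg_right hcb (sq_nonneg φ)
  have h5 := mul_le_mul_of_nonneg_right hca (mul_nonneg hγ.le (sq_nonneg e))
  linarith

/-! ### Existence and uniqueness for the adaptive system -/

/-- The vector field of the adaptive system in the variables `(x, xm, θh)`. -/
def ormField (a b θ γ r : ℝ) (p : ℝ × ℝ × ℝ) : ℝ × ℝ × ℝ :=
  (a * p.1 - b * θ * p.1 + b * (p.2.2 * p.1 + r), a * p.2.1 + b * r,
    -γ * p.1 * (p.1 - p.2.1))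

theorem contDiff_ormField (a b θ γ r : ℝ) : ContDiff ℝ 1 (ormField a b θ γ r) := by
  unfold ormField
  fun_prop

theorem IsORMSolution.hasDerivWithinAt_ormField {a b θ γ r t₀ : ℝ} {x xm θh : ℝ → ℝ}
    (h : IsORMSolution a b θ γ r t₀ x xm θh) {t : ℝ} (ht : t₀ ≤ t) :
    HasDerivWithinAt (fun t => (x t, xm t, θh t)) (ormField a b θ γ r (x t, xm t, θh t))
      (Ici t₀) t :=
  (h.plant t ht).prodMk ((h.reference t ht).prodMk (h.update t ht))

theorem IsORMSolution.unique {a b θ γ r t₀ : ℝ} {x xm θh x' xm' θh' : ℝ → ℝ}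
    (h : IsORMSolution a b θ γ r t₀ x xm θh) (h' : IsORMSolution a b θ γ r t₀ x' xm' θh')
    (hx : x t₀ = x' t₀) (hxm : xm t₀ = xm' t₀) (hθ : θh t₀ = θh' t₀) {t : ℝ} (ht : t₀ ≤ t) :
    x t = x' t ∧ xm t = xm' t ∧ θh t = θh' t := by
  have := eqOn_Ici_of_hasDerivWithinAt_of_contDiff (contDiff_ormField a b θ γ r)
    (fun t ht => h.hasDerivWithinAt_ormField ht) (fun t ht => h'.hasDerivWithinAt_ormField ht)
    (by simp [hx, hxm, hθ]) ht
  simpa using this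

/-- The quadratic Lyapunov function does not increase along the system slowed down by a factor
`w ≥ 0`. -/
theorem lyapunov_le_of_hasDerivWithinAt {a b θ γ r t₀ : ℝ} {x xm θh w : ℝ → ℝ} (ha : a < 0)
    (hγ : 0 < γ) (hw : ∀ t, 0 ≤ w t)
    (hx : ∀ t, t₀ ≤ t → HasDerivWithinAt x
      (w t * (a * x t - b * θ * x t + b * (θh t * x t + r))) (Ici t₀) t)
    (hxm : ∀ t, t₀ ≤ t → HasDerivWithinAt xm (w t * (a * xm t + b * r)) (Ici t₀) t)
    (hθ : ∀ t, t₀ ≤ t → HasDerivWithinAt θh (w t * (-γ * x t * (x t - xm t))) (Ici t₀) t)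
    {t : ℝ} (ht : t₀ ≤ t) :
    γ * (x t - xm t) ^ 2 + b * (θh t - θ) ^ 2 ≤
      γ * (x t₀ - xm t₀) ^ 2 + b * (θh t₀ - θ) ^ 2 := by
  refine le_of_hasDerivWithinAt_Ici_nonpos
    (f := fun t => γ * (x t - xm t) ^ 2 + b * (θh t - θ) ^ 2)
    (f' := fun t => w t * (2 * γ * a * (x t - xm t) ^ 2)) (fun s hs => ?_) (fun s hs => ?_) ht
  · refine ((((hx s hs).fun_sub (hxm s hs)).fun_pow 2 |>.const_mul γ).fun_add
      (((hθ s hs).sub_const θ).fun_pow 2 |>.const_mul b)).congr_deriv ?_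
    push_cast
    ring
  · refine mul_nonpos_of_nonneg_of_nonpos (hw s) ?_
    nlinarith [mul_nonneg (mul_nonneg hγ.le (neg_nonneg.2 ha.le)) (sq_nonneg (x s - xm s))]

theorem IsORMSolution.lyapunov_le {a b θ γ r t₀ : ℝ} {x xm θh : ℝ → ℝ} (ha : a < 0)
    (hγ : 0 < γ) (h : IsORMSolution a b θ γ r t₀ x xm θh) {t : ℝ} (ht : t₀ ≤ t) :
    γ * (x t - xm t) ^ 2 + b * (θh t - θ) ^ 2 ≤
      γ * (x t₀ - xm t₀) ^ 2 + b * (θh t₀ - θ) ^ 2 :=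
  lyapunov_le_of_hasDerivWithinAt (w := fun _ => 1) ha hγ (fun _ => zero_le_one)
    (fun t ht => by simpa using h.plant t ht) (fun t ht => by simpa using h.reference t ht)
    (fun t ht => by simpa using h.update t ht) ht

theorem abs_le_sqrt_div_of_mul_sq_le {c y V : ℝ} (hc : 0 < c) (h : c * y ^ 2 ≤ V) :
    |y| ≤ √(V / c) :=
  Real.abs_le_sqrt (by rwa [le_div_iff₀ hc, mul_comm])

/-- Multiplying the field by a bump function makes it bounded and Lipschitz. The cutoff only
rescales time, so `V` and `(a xm + b r)²` still do not increase, and the trajectory never leaves the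
ball where the cutoff is `1`. -/
theorem exists_isORMSolution {a b θ γ r : ℝ} (ha : a < 0) (hb : 0 < b) (hγ : 0 < γ)
    (t₀ x₀ xm₀ θ₀ : ℝ) :
    ∃ x xm θh : ℝ → ℝ, IsORMSolution a b θ γ r t₀ x xm θh ∧
      x t₀ = x₀ ∧ xm t₀ = xm₀ ∧ θh t₀ = θ₀ := by
  set V : ℝ := γ * (x₀ - xm₀) ^ 2 + b * (θ₀ - θ) ^ 2 with hV
  set M : ℝ := √((a * xm₀ + b * r) ^ 2) + |b * r| with hM
  -- `M / |a|`, `√(V / γ)` and `√(V / b)` bound `|xm|`, `|e|` and `|φ|`, hence all three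
  -- coordinates.
  set R : ℝ := 1 + M / |a| + √(V / γ) + √(V / b) + |θ| with hR
  have hM0 : 0 ≤ M / |a| := by positivity
  have hRpos : 0 < R := by positivity
  let χ : ContDiffBump (0 : ℝ × ℝ × ℝ) := ⟨R, R + 1, hRpos, lt_add_one R⟩
  have hsmooth : ContDiff ℝ 1 (fun p => χ p • ormField a b θ γ r p) :=
    χ.contDiff.smul (contDiff_ormField a b θ γ r)
  have hsupp : HasCompactSupport (fun p => χ p • ormField a b θ γ r p) :=
    χ.hasCompactSupport.smul_right
  obtain ⟨K, hK⟩ := hsmooth.lipschitzWith_of_hasCompactSupport hsupp one_ne_zero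
  obtain ⟨C, hC⟩ := hsupp.exists_bound_of_continuous hsmooth.continuous
  obtain ⟨α, hα0, hα⟩ := exists_hasDerivAt_of_lipschitzWith_of_bounded hK hC t₀ (x₀, xm₀, θ₀)
  have hx (t : ℝ) : HasDerivAt (fun t => (α t).1) (χ (α t) * (a * (α t).1 - b * θ * (α t).1
      + b * ((α t).2.2 * (α t).1 + r))) t := by
    exact hasFDerivAt_fst.comp_hasDerivAt t (hα t)
  have hxm (t : ℝ) : HasDerivAt (fun t => (α t).2.1) (χ (α t) * (a * (α t).2.1 + b * r)) t := by
    exact hasFDerivAt_fst.comp_hasDerivAt t (hasFDerivAt_snd.comp_hasDerivAt t (hα t))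
  have hθ (t : ℝ) : HasDerivAt (fun t => (α t).2.2)
      (χ (α t) * (-γ * (α t).1 * ((α t).1 - (α t).2.1))) t := by
    exact hasFDerivAt_snd.comp_hasDerivAt t (hasFDerivAt_snd.comp_hasDerivAt t (hα t))
  have hball (t : ℝ) (ht : t₀ ≤ t) : χ (α t) = 1 := by
    have hVt := lyapunov_le_of_hasDerivWithinAt (w := fun t => χ (α t)) ha hγ
      (fun t => χ.nonneg) (fun t _ => (hx t).hasDerivWithinAt)
      (fun t _ => (hxm t).hasDerivWithinAt) (fun t _ => (hθ t).hasDerivWithinAt) ht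
    simp only [hα0, ← hV] at hVt
    have hmt := le_of_hasDerivWithinAt_Ici_nonpos (t₀ := t₀)
      (f := fun t => (a * (α t).2.1 + b * r) ^ 2)
      (f' := fun t => χ (α t) * (2 * a * (a * (α t).2.1 + b * r) ^ 2))
      (fun s _ => (((((hxm s).const_mul a).add_const (b * r)).fun_pow 2).congr_deriv
        (by push_cast; ring)).hasDerivWithinAt)
      (fun s _ => mul_nonpos_of_nonneg_of_nonpos χ.nonneg
        (mul_nonpos_of_nonpos_of_nonneg (by linarith) (sq_nonneg _))) ht
    simp only [hα0] at hmt
    have h1 := abs_le_sqrt_div_of_mul_sq_le hγ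
      ((le_add_of_nonneg_right (by positivity)).trans hVt)
    have h2 := abs_le_sqrt_div_of_mul_sq_le hb
      ((le_add_of_nonneg_left (by positivity)).trans hVt)
    have h3 : |(α t).2.1| ≤ M / |a| := by
      rw [le_div_iff₀ (abs_pos.2 ha.ne), mul_comm, ← abs_mul]
      have h4 := Real.abs_le_sqrt hmt
      have h5 := abs_sub (a * (α t).2.1 + b * r) (b * r)
      rw [add_sub_cancel_right] at h5
      linarith
    have h6 : 0 ≤ √(V / γ) := Real.sqrt_nonneg _
    have h7 : 0 ≤ √(V / b) := Real.sqrt_nonneg _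
    have h8 : 0 ≤ |θ| := abs_nonneg _
    refine χ.one_of_mem_closedBall (mem_closedBall_zero_iff.2 ?_)
    change ‖α t‖ ≤ R
    refine norm_prod_le_iff.2 ⟨?_, norm_prod_le_iff.2 ⟨?_, ?_⟩⟩ <;> rw [Real.norm_eq_abs]
    · have := abs_add_le ((α t).1 - (α t).2.1) (α t).2.1
      rw [sub_add_cancel] at this
      linarith
    · linarith
    · have := abs_add_le ((α t).2.2 - θ) θ
      rw [sub_add_cancel] at this
      linarith
  refine ⟨fun t => (α t).1, fun t => (α t).2.1, fun t => (α t).2.2, ⟨?_, ?_, ?_⟩, ?_, ?_, ?_⟩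
  · intro t ht
    simpa only [hball t ht, one_mul] using (hx t).hasDerivWithinAt (s := Ici t₀)
  · intro t ht
    simpa only [hball t ht, one_mul] using (hxm t).hasDerivWithinAt (s := Ici t₀)
  · intro t ht
    simpa only [hball t ht, one_mul] using (hθ t).hasDerivWithinAt (s := Ici t₀)
  all_goals simp [hα0]

/-! ### Uniform exponential decay -/

/-- Exponential decay of the error with a rate that depends only on a bound `V₀` of the initial
value of the quadratic Lyapunov function, not on the reference state. -/
theorem exists_exponential_decay {a b θ γ r : ℝ} (ha : a < 0) (hb : 0 < b) (hγ : 0 < γ)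
    (hr : r ≠ 0) (V₀ : ℝ) :
    ∃ c : ℝ, 0 < c ∧ ∀ (t₀ : ℝ) (x xm θh : ℝ → ℝ), IsORMSolution a b θ γ r t₀ x xm θh →
      γ * (x t₀ - xm t₀) ^ 2 + b * (θh t₀ - θ) ^ 2 ≤ V₀ → ∀ t, t₀ ≤ t →
      γ * (x t - xm t) ^ 2 + b * (θh t - θ) ^ 2 ≤ 4 * V₀ * Real.exp (-(c * (t - t₀))) := by
  -- Since `V ≤ V₀` persists, `|φ| ≤ Φ` and `|p| ≤ P` for all later times, whatever the reference
  -- state.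
  set Φ : ℝ := √(V₀ / b) with hΦ
  have hΦ0 : 0 ≤ Φ := Real.sqrt_nonneg _
  set P : ℝ := |a| + b * Φ with hP
  have hP0 : 0 ≤ P := by positivity
  obtain ⟨l, k, c, hc, hlk⟩ := exists_lyapunov_coefficients (s := b * r) (D := P + |b * r|)
    (C := 3 * (b * r) ^ 2 + P ^ 2) ha hb hγ (mul_ne_zero hb.ne' hr) (by positivity) (by positivity)
  refine ⟨c, hc, fun t₀ x xm θh h hV₀ t ht => ?_⟩
  have coeff (s : ℝ) (hs : t₀ ≤ s) := by
    have hφ : |θh s - θ| ≤ Φ := abs_le_sqrt_div_of_mul_sq_le hb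
      ((le_add_of_nonneg_left (by positivity)).trans ((h.lyapunov_le ha hγ hs).trans hV₀))
    have hp : |a + b * (θh s - θ)| ≤ P := by
      refine (abs_add_le _ _).trans ?_
      rw [abs_mul, abs_of_pos hb]
      linarith [mul_le_mul_of_nonneg_left hφ hb.le]
    have hq0 : 0 ≤ x s ^ 2 / (1 + x s ^ 2) := by positivity
    refine hlk (x s - xm s) (θh s - θ) (x s / (1 + x s ^ 2)) (x s ^ 2 / (1 + x s ^ 2))
      ((1 - x s ^ 2) / (1 + x s ^ 2) ^ 2 * ((a + b * (θh s - θ)) * x s + b * r))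
      (abs_div_one_add_sq_le _) hq0 ?_ ?_ ?_
    · rw [div_le_one (by positivity)]; linarith
    · exact (abs_deriv_div_one_add_sq_le _ _ _).trans (by gcongr)
    · refine le_trans ?_ (le_mul_deriv_div_one_add_sq _ _ _)
      have : (a + b * (θh s - θ)) ^ 2 ≤ P ^ 2 := sq_le_sq' (abs_le.1 hp).1 (abs_le.1 hp).2
      gcongr
  have decay := le_mul_exp_of_hasDerivWithinAt_Ici (t₀ := t₀) (c := c)
    (f := fun s => γ * (x s - xm s) ^ 2 + b * (θh s - θ) ^ 2
      - l * ((x s - xm s) * (θh s - θ) * (x s / (1 + x s ^ 2)))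
      - k * ((θh s - θ) ^ 2 * (x s / (1 + x s ^ 2)))) (fun s hs => ?_)
    (fun s hs => (coeff s hs).2.2) ht
  -- `V / 2 ≤ W ≤ 2 V` at the two ends accounts for the factor `4`.
  · have h0 := (coeff t₀ le_rfl).2.1
    have h1 := (coeff t ht).1
    have h2 := mul_le_mul_of_nonneg_right (h0.trans (mul_le_mul_of_nonneg_left hV₀ zero_le_two))
      (Real.exp_pos (-(c * (t - t₀)))).le
    linarith [decay.trans h2]
  · have he := (h.plant s hs).fun_sub (h.reference s hs)
    have hφ := (h.update s hs).sub_const θ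
    have hg := (hasDerivAt_div_one_add_sq (x s)).comp_hasDerivWithinAt s (h.plant s hs)
    have hW := (((he.fun_pow 2).const_mul γ).fun_add ((hφ.fun_pow 2).const_mul b)).fun_sub
      (((he.fun_mul hφ).fun_mul hg).const_mul l) |>.fun_sub
      (((hφ.fun_pow 2).fun_mul hg).const_mul k)
    refine hW.congr_deriv ?_
    have hx : (1 + x s ^ 2 : ℝ) ≠ 0 := by positivity
    simp only [Function.comp_apply]
    push_cast
    field_simp
    ring

/-! ### From `V` to the Euclidean norm -/

theorem sq_norm_error_vec (y z : ℝ) : ‖(!₂[y, z] : Plane)‖ ^ 2 = y ^ 2 + z ^ 2 := by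
  simp [EuclideanSpace.norm_sq_eq, Fin.sum_univ_two]

theorem min_mul_le_weighted_sq (γ b y z : ℝ) :
    min γ b * (y ^ 2 + z ^ 2) ≤ γ * y ^ 2 + b * z ^ 2 := by
  nlinarith [mul_le_mul_of_nonneg_right (min_le_left γ b) (sq_nonneg y),
    mul_le_mul_of_nonneg_right (min_le_right γ b) (sq_nonneg z)]

theorem weighted_sq_le_max_mul (γ b y z : ℝ) :
    γ * y ^ 2 + b * z ^ 2 ≤ max γ b * (y ^ 2 + z ^ 2) := by
  nlinarith [mul_le_mul_of_nonneg_right (le_max_left γ b) (sq_nonneg y),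
    mul_le_mul_of_nonneg_right (le_max_right γ b) (sq_nonneg z)]

/-- Monotonicity of `V` and its equivalence with `‖z‖²` give one linear bound that serves both
stability and boundedness. -/
theorem norm_le_of_mem_ormErrorTrajectories {a b θ γ r : ℝ} (ha : a < 0) (hb : 0 < b)
    (hγ : 0 < γ) {t₀ : ℝ} {z : ℝ → Plane} (hz : z ∈ ormErrorTrajectories a b θ γ r t₀)
    {t : ℝ} (ht : t₀ ≤ t) : ‖z t‖ ≤ √(max γ b / min γ b) * ‖z t₀‖ := by
  obtain ⟨x, xm, θh, h, hz⟩ := hz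
  have hmin : 0 < min γ b := lt_min hγ hb
  have hmax : 0 < max γ b := hγ.trans_le (le_max_left _ _)
  refine abs_le_of_sq_le_sq' ?_ (by positivity) |>.2
  rw [mul_pow, Real.sq_sqrt (by positivity), div_mul_eq_mul_div, le_div_iff₀ hmin, mul_comm,
    hz t ht, hz t₀ le_rfl, sq_norm_error_vec, sq_norm_error_vec]
  exact (min_mul_le_weighted_sq _ _ _ _).trans
    ((h.lyapunov_le ha hγ ht).trans (weighted_sq_le_max_mul _ _ _ _))

theorem uniformlyAttractingInTheLarge_ormErrorTrajectories {a b θ γ r : ℝ} (ha : a < 0)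
    (hb : 0 < b) (hγ : 0 < γ) (hr : r ≠ 0) :
    UniformlyAttractingInTheLarge (ormErrorTrajectories a b θ γ r) := by
  intro ρ hρ η hη
  have hmin : 0 < min γ b := lt_min hγ hb
  have hmax : 0 < max γ b := hγ.trans_le (le_max_left _ _)
  obtain ⟨c, hc, hdecay⟩ := exists_exponential_decay (θ := θ) ha hb hγ hr (max γ b * ρ ^ 2)
  have hlim : Tendsto (fun T : ℝ => 4 * (max γ b * ρ ^ 2) * Real.exp (-(c * T))) atTop (𝓝 0) := by
    simpa using (Real.tendsto_exp_neg_atTop_nhds_zero.comp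
      (tendsto_id.const_mul_atTop hc)).const_mul (4 * (max γ b * ρ ^ 2))
  obtain ⟨T, hT0, hT⟩ := ((eventually_ge_atTop (0 : ℝ)).and
    (hlim.eventually_lt_const (show 0 < min γ b * η ^ 2 by positivity))).exists
  refine ⟨T, hT0, fun t₀ _ z hz hz0 t ht => ?_⟩
  obtain ⟨x, xm, θh, h, hz⟩ := hz
  have ht' : t₀ ≤ t := by linarith
  rw [hz t₀ le_rfl] at hz0
  have hV₀ : γ * (x t₀ - xm t₀) ^ 2 + b * (θh t₀ - θ) ^ 2 ≤ max γ b * ρ ^ 2 := by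
    refine (weighted_sq_le_max_mul _ _ _ _).trans (mul_le_mul_of_nonneg_left ?_ hmax.le)
    rw [← sq_norm_error_vec]
    exact pow_le_pow_left₀ (norm_nonneg _) hz0 2
  refine abs_le_of_sq_le_sq' ?_ hη.le |>.2
  rw [hz t ht', sq_norm_error_vec]
  refine le_of_mul_le_mul_left ?_ hmin
  refine (min_mul_le_weighted_sq _ _ _ _).trans
    ((hdecay t₀ x xm θh h hV₀ t ht').trans (le_trans ?_ hT.le))
  have : T ≤ t - t₀ := by linarith
  gcongr

theorem isUASL_ormErrorTrajectories {a b θ γ r : ℝ} (ha : a < 0) (hb : 0 < b) (hγ : 0 < γ)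
    (hr : r ≠ 0) : IsUASL (ormErrorTrajectories a b θ γ r) := by
  have hκ : 0 < √(max γ b / min γ b) :=
    Real.sqrt_pos.2 (div_pos (hγ.trans_le (le_max_left _ _)) (lt_min hγ hb))
  refine ⟨fun ε hε => ⟨ε / √(max γ b / min γ b), by positivity, fun t₀ _ z hz h t ht => ?_⟩,
    fun ρ _ => ⟨√(max γ b / min γ b) * ρ, fun t₀ _ z hz h t ht => ?_⟩,
    uniformlyAttractingInTheLarge_ormErrorTrajectories ha hb hγ hr⟩
  · rw [le_div_iff₀ hκ, mul_comm] at h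
    exact (norm_le_of_mem_ormErrorTrajectories ha hb hγ hz ht).trans h
  · exact (norm_le_of_mem_ormErrorTrajectories ha hb hγ hz ht).trans
      (mul_le_mul_of_nonneg_left h hκ.le)

theorem mainTheorem7 (a b θ γ r : ℝ) (ha : a < 0) (hb : 0 < b) (hγ : 0 < γ) (hr : r ≠ 0) :
    -- the system has exactly one solution on `[t₀, ∞)` for all initial data
    (∀ t₀ : ℝ, 0 ≤ t₀ → ∀ x₀ xm₀ θ₀ : ℝ,
      (∃ x xm θh : ℝ → ℝ, IsORMSolution a b θ γ r t₀ x xm θh ∧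
        x t₀ = x₀ ∧ xm t₀ = xm₀ ∧ θh t₀ = θ₀) ∧
      (∀ x xm θh x' xm' θh' : ℝ → ℝ,
        IsORMSolution a b θ γ r t₀ x xm θh → IsORMSolution a b θ γ r t₀ x' xm' θh' →
        x t₀ = x₀ → xm t₀ = xm₀ → θh t₀ = θ₀ → x' t₀ = x₀ → xm' t₀ = xm₀ → θh' t₀ = θ₀ →
        ∀ t ≥ t₀, x t = x' t ∧ xm t = xm' t ∧ θh t = θh' t)) ∧
    -- the equilibrium `z = 0` of the error dynamics is UASL
    IsUASL (ormErrorTrajectories a b θ γ r) := by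
  refine ⟨fun t₀ _ x₀ xm₀ θ₀ => ⟨exists_isORMSolution ha hb hγ t₀ x₀ xm₀ θ₀, ?_⟩,
    isUASL_ormErrorTrajectories ha hb hγ hr⟩
  intro x xm θh x' xm' θh' h h' hx hxm hθ hx' hxm' hθ' t ht
  exact h.unique h' (hx.trans hx'.symm) (hxm.trans hxm'.symm) (hθ.trans hθ'.symm) ht
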